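/- Let $f$ be a probability density on $\mathbb{R}^d$ and, for $t\in\mathbb{R}$, let $G(t)=\{x\in\mathbb{R}^d: f(x)\ge t\}$. Let $p\ge 1$ be an integer and let $-\infty<l\le u<\sup f<\infty$. Assume that for every $t\in[l,u]$ the level set $G(t)$ is compact, nonempty and nonconvex, and that the following conditions hold. (A) There are $\zeta>0$ and a bounded open set $U$ containing $\overline{G(l-\zeta)}\setminus\operatorname{int}(G(u+\zeta))$ such that $G(u+\zeta)$ is bounded, $f\in\mathcal{C}^p(U)$ and, for some constants $m>0$ and $k$, $|\nabla f(x)|\ge m$ and $|\nabla f(x)-\nabla f(y)|\le k|x-y|$ for all $x,y\in U$. (K) $K:\mathbb{R}^d\to\mathbb{R}$ is a continuous kernel with bounded support and finite (total) variation, of order at least $p$; that is, $\int K=1$ and $\int z^\alpha K(z)\,dz=0$ for every multi-index $\alpha$ with $1\le|\alpha|\le p-1$. The bandwidths $h=h_n$ are positive for large $n$ and of exact order $(\log n/n)^{1/(d+2p)}$; that is, $h_n/(\log n/n)^{1/(d+2p)}$ is bounded and bounded away from $0$ for large $n$. Let $X_1,X_2,\dots$ be independent random vectors with density $f$, $\mathcal{X}_n=\{X_1,\dots,X_n\}$,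 and let $f_n(x)=\frac{1}{nh_n^d}\sum_{i=1}^n K\left(\frac{x-X_i}{h_n}\right)$ be the kernel density estimator. For $M>0$ let $D_n=M(\log n/n)^{p/(d+2p)}$ and $$\mathcal{X}_n^+(t)=\{X\in\mathcal{X}_n: f_n(X)\ge t+D_n\}.$$ Then there is $M_0>0$, depending only on $d,p,f,l,u,K$ and $(h_n)$, such that for every $M\ge M_0$ and every $\epsilon>0$, $$\mathbb{P}\Big(\sup_{t\in[l,u]}\ \sup_{x\in G(t)} d\big(x,\mathcal{X}_n^+(t)\big)\le\epsilon \text{ eventually}\Big)=1,$$ where $d(x,A)=\inf_{a\in A}\|x-a\|$, $d(x,\emptyset)=+\infty$, and "eventually" means for all sufficiently large $n$. In particular, with probability one, $\mathcal{X}_n^+(t)\neq\emptyset$ for all $t\in[l,u]$ and all sufficiently large $n$. -/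

import Mathlib

open MeasureTheory ProbabilityTheory Filter Asymptotics Set
open scoped ENNReal Topology

noncomputable section

namespace LevelSetEstimation

/-- `f` is a probability density on `ℝᵈ` with respect to Lebesgue measure. -/
structure IsDensity {d : ℕ} (f : EuclideanSpace ℝ (Fin d) → ℝ) : Prop where
  measurable : Measurable f
  nonneg : ∀ x, 0 ≤ f x
  lintegral_eq_one : ∫⁻ x, ENNReal.ofReal (f x) = 1

/-- The level set `G(t) = {x : f x ≥ t}`. -/
def levelSet {d : ℕ} (f : EuclideanSpace ℝ (Fin d) → ℝ) (t : ℝ) :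
    Set (EuclideanSpace ℝ (Fin d)) :=
  {x | t ≤ f x}

/-- Assumption (A) on the density `f`, the range of levels `[l, u]` and the smoothness `p`. -/
structure AssumptionA {d : ℕ} (f : EuclideanSpace ℝ (Fin d) → ℝ) (l u : ℝ) (p : ℕ) : Prop where
  l_le_u : l ≤ u
  bddAbove : BddAbove (range f)
  u_lt_sup : u < ⨆ x, f x
  one_le_p : 1 ≤ p
  regular : ∃ ζ > 0, ∃ U : Set (EuclideanSpace ℝ (Fin d)),
    IsOpen U ∧ Bornology.IsBounded U ∧
    closure (levelSet f (l - ζ)) \ interior (levelSet f (u + ζ)) ⊆ U ∧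
    Bornology.IsBounded (levelSet f (u + ζ)) ∧
    ContDiffOn ℝ p f U ∧
    (∃ m > 0, ∀ x ∈ U, m ≤ ‖gradient f x‖) ∧
    (∃ k : ℝ, ∀ x ∈ U, ∀ y ∈ U, ‖gradient f x - gradient f y‖ ≤ k * ‖x - y‖)

/-- The divergence of a vector field on `ℝᵈ`. -/
def divergence {d : ℕ} (φ : EuclideanSpace ℝ (Fin d) → EuclideanSpace ℝ (Fin d))
    (x : EuclideanSpace ℝ (Fin d)) : ℝ :=
  ∑ i, fderiv ℝ φ x (EuclideanSpace.single i 1) i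

/-- Finite total variation on `ℝᵈ`: the supremum of `∫ K div φ` over the smooth compactly
supported vector fields `φ` with `|φ| ≤ 1` is finite. -/
def HasFiniteVariation {d : ℕ} (K : EuclideanSpace ℝ (Fin d) → ℝ) : Prop :=
  ∃ V : ℝ, ∀ φ : EuclideanSpace ℝ (Fin d) → EuclideanSpace ℝ (Fin d),
    ContDiff ℝ ((⊤ : ℕ∞) : WithTop ℕ∞) φ → HasCompactSupport φ → (∀ x, ‖φ x‖ ≤ 1) →
    ∫ x, K x * divergence φ x ≤ V

/-- `K` is a kernel of order at least `p`: it has integral one, and its moments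
`∫ zᵅ K(z) dz` vanish for all multi-indices `α` with `1 ≤ |α| ≤ p - 1`. -/
structure HasOrderAtLeast {d : ℕ} (K : EuclideanSpace ℝ (Fin d) → ℝ) (p : ℕ) : Prop where
  integrable : Integrable K
  integral_eq_one : ∫ z, K z = 1
  moment_eq_zero : ∀ α : Fin d → ℕ, 1 ≤ ∑ i, α i → ∑ i, α i < p →
    Integrable (fun z => (∏ i, z i ^ α i) * K z) ∧ ∫ z, (∏ i, z i ^ α i) * K z = 0

/-- Assumption (K) on the kernel `K` and the bandwidth sequence `h`. -/
structure AssumptionK {d : ℕ} (K : EuclideanSpace ℝ (Fin d) → ℝ) (h : ℕ → ℝ) (p : ℕ) :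
    Prop where
  continuous : Continuous K
  order : HasOrderAtLeast K p
  bounded_support : Bornology.IsBounded (Function.support K)
  finite_variation : HasFiniteVariation K
  bandwidth_pos : ∀ᶠ n in atTop, 0 < h n
  bandwidth_order :
    h =Θ[atTop] fun n : ℕ => (Real.log n / n) ^ ((1 : ℝ) / ((d : ℝ) + 2 * (p : ℝ)))

/-- The sequence `Dₙ = M (log n / n)^(p / (d + 2p))`. -/
def gap (d p : ℕ) (M : ℝ) (n : ℕ) : ℝ :=
  M * (Real.log n / n) ^ ((p : ℝ) / ((d : ℝ) + 2 * (p : ℝ)))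

/-- The kernel density estimator at `x`, from the first `n` of the points `X 0, X 1, …`, with
bandwidth `b`. -/
def kernelEstimator {d : ℕ} (K : EuclideanSpace ℝ (Fin d) → ℝ) (b : ℝ)
    (X : ℕ → EuclideanSpace ℝ (Fin d)) (n : ℕ) (x : EuclideanSpace ℝ (Fin d)) : ℝ :=
  1 / ((n : ℝ) * b ^ d) * ∑ i ∈ Finset.range n, K (b⁻¹ • (x - X i))

/-- The subsample `𝒳ₙ⁺(t) = {X ∈ 𝒳ₙ : fₙ(X) ≥ t + D}` of `𝒳ₙ = {X 0, …, X (n - 1)}`, where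
`fₙ` is the kernel estimator with bandwidth `b`. -/
def plusSample {d : ℕ} (K : EuclideanSpace ℝ (Fin d) → ℝ) (b D : ℝ)
    (X : ℕ → EuclideanSpace ℝ (Fin d)) (n : ℕ) (t : ℝ) : Set (EuclideanSpace ℝ (Fin d)) :=
  {x | (∃ i < n, X i = x) ∧ t + D ≤ kernelEstimator K b X n x}

/-- `X 0, X 1, …` are independent random vectors, each with density `f`. -/
structure IsRandomSample {d : ℕ} {Ω : Type*} [MeasurableSpace Ω] (P : Measure Ω)
    (X : ℕ → Ω → EuclideanSpace ℝ (Fin d)) (f : EuclideanSpace ℝ (Fin d) → ℝ) : Prop where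
  measurable : ∀ i, Measurable (X i)
  indep : iIndepFun X P
  law : ∀ i, P.map (X i) = volume.withDensity fun x => ENNReal.ofReal (f x)

end LevelSetEstimation

end

/-! Only `D_n → 0` matters, not its rate, so every `M` works and pointwise consistency replaces
uniform rates. Given `t ∈ [l, u]` and `t ≤ f x`, every ball around `x` contains a set of positive
volume on which `f` exceeds `t` by a fixed margin, because a nonvanishing gradient excludes local
maxima. Almost surely some observation `X i` lands there. Its index is then fixed while `n` grows,
so `f_n (X i) → f (X i)` eventually puts it in the plus sample. The pairs `(x, t)` form a compact
set (`isCompact_hypograph`), so finitely many such observations serve all of them at once.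

Consistency at `X i` (`IsRandomSample.ae_tendsto_kernelEstimator`) splits into a bias, which
vanishes at Lebesgue points of `f` and hence almost surely at `X i`, and a fluctuation, controlled
by a Chernoff bound given `X i`. As `n h_n ^ d` dominates `log n`, that bound is at most `2 / n ^
2`, and Borel–Cantelli applies. -/

namespace LevelSetEstimation

/-! ### Higher density near every point of a level set -/

/-- In `U` the gradient is nonzero, so `x` is no local maximum and some nearby `y` has `f y > f x`;
continuity at `y` thickens it to a neighbourhood. Outside `U` the point is interior to `G(u + ζ)`,
where `f` is already above `t`. -/
theorem volume_ball_inter_superlevel_pos {d p : ℕ} {f : EuclideanSpace ℝ (Fin d) → ℝ} {l u : ℝ}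
    (hA : AssumptionA f l u p) {t : ℝ} (ht : t ∈ Icc l u) {x : EuclideanSpace ℝ (Fin d)}
    (hx : t ≤ f x) {r : ℝ} (hr : 0 < r) :
    0 < volume (Metric.ball x r ∩ {y | t < f y}) := by
  obtain ⟨ζ, hζ, U, hUo, -, hU, -, hC, ⟨m, hm, hgrad⟩, -⟩ := hA.regular
  by_cases hxU : x ∈ U
  · have hmax : ¬ IsLocalMax f x := by
      intro hloc
      have h0 : gradient f x = 0 := by
        simp [gradient, hloc.fderiv_eq_zero]
      have := hgrad x hxU
      rw [h0, norm_zero] at this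
      linarith
    have hfreq : ∃ᶠ y in 𝓝 x, f x < f y := fun hev =>
      hmax (hev.mono fun y hy => not_lt.1 hy)
    have hmem : ∀ᶠ y in 𝓝 x, y ∈ U ∧ y ∈ Metric.ball x r :=
      inter_mem (hUo.mem_nhds hxU) (Metric.ball_mem_nhds x hr)
    obtain ⟨y, hy, hyU, hyr⟩ := (hfreq.and_eventually hmem).exists
    have hcont : ContinuousAt f y := hC.continuousOn.continuousAt (hUo.mem_nhds hyU)
    refine Measure.measure_pos_of_mem_nhds volume
      (inter_mem (Metric.isOpen_ball.mem_nhds hyr) ?_) (x := y)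
    exact hcont.eventually (lt_mem_nhds (hx.trans_lt hy))
  · have hcl : x ∈ closure (levelSet f (l - ζ)) := by
      refine subset_closure ?_
      simp only [levelSet, mem_ofPred_eq]
      linarith [ht.1]
    have hint : x ∈ interior (levelSet f (u + ζ)) := by
      by_contra hn
      exact hxU (hU ⟨hcl, hn⟩)
    refine Measure.measure_pos_of_mem_nhds volume
      (inter_mem (Metric.ball_mem_nhds x hr) ?_) (x := x)
    refine mem_of_superset (mem_interior_iff_mem_nhds.1 hint) fun y hy => ?_
    simp only [levelSet, mem_ofPred_eq] at hy ⊢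
    linarith [ht.2]

theorem exists_volume_ball_inter_superlevel_add_pos {d p : ℕ}
    {f : EuclideanSpace ℝ (Fin d) → ℝ} {l u : ℝ}
    (hA : AssumptionA f l u p) {t : ℝ} (ht : t ∈ Icc l u) {x : EuclideanSpace ℝ (Fin d)}
    (hx : t ≤ f x) {r : ℝ} (hr : 0 < r) :
    ∃ δ > 0, 0 < volume (Metric.ball x r ∩ {y | t + δ < f y}) := by
  by_contra! hcon
  have hpos := volume_ball_inter_superlevel_pos hA ht hx hr
  have hsub : Metric.ball x r ∩ {y | t < f y} ⊆
      ⋃ k : ℕ, Metric.ball x r ∩ {y | t + 1 / ((k : ℝ) + 1) < f y} := by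
    rintro y ⟨hy, hty⟩
    obtain ⟨k, hk⟩ := exists_nat_one_div_lt (K := ℝ) (ε := f y - t) (sub_pos.2 hty)
    exact mem_iUnion.2 ⟨k, hy, by simp only [mem_ofPred_eq]; linarith⟩
  have hzero : volume (⋃ k : ℕ, Metric.ball x r ∩ {y | t + 1 / ((k : ℝ) + 1) < f y}) = 0 :=
    measure_iUnion_null fun k => nonpos_iff_eq_zero.1 (hcon _ (by positivity))
  exact hpos.ne' (measure_mono_null hsub hzero)

/-- Each event `X i ∈ S` has the same positive probability, so the second Borel–Cantelli lemma gives
infinitely many hits. -/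
theorem IsRandomSample.ae_exists_mem {d : ℕ} {Ω : Type*} [MeasurableSpace Ω] {P : Measure Ω}
    [IsProbabilityMeasure P] {X : ℕ → Ω → EuclideanSpace ℝ (Fin d)}
    {f : EuclideanSpace ℝ (Fin d) → ℝ} (hX : IsRandomSample P X f) (hf : Measurable f)
    {S : Set (EuclideanSpace ℝ (Fin d))} (hS : MeasurableSet S) (hvol : 0 < volume S)
    (hpos : ∀ x ∈ S, 0 < f x) : ∀ᵐ ω ∂P, ∃ i, X i ω ∈ S := by
  have hmeas : ∀ i, MeasurableSet (X i ⁻¹' S) := fun i => hX.measurable i hS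
  have hprob : ∀ i, P (X i ⁻¹' S) = ∫⁻ x in S, ENNReal.ofReal (f x) := by
    intro i
    rw [← Measure.map_apply (hX.measurable i) hS, hX.law i, withDensity_apply _ hS]
  have hne : ∫⁻ x in S, ENNReal.ofReal (f x) ≠ 0 := by
    refine (setLIntegral_pos_iff hf.ennreal_ofReal).2 ?_ |>.ne'
    refine hvol.trans_le (measure_mono fun x hx => ⟨?_, hx⟩)
    simpa using hpos x hx
  have hind : iIndepSet (fun i => X i ⁻¹' S) P :=
    (iIndepSet_iff_meas_biInter hmeas).2 fun s =>
      hX.indep.measure_inter_preimage_eq_mul s fun _ _ => hS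
  have hone := measure_limsup_eq_one hmeas hind (by
    simp only [hprob]
    exact ENNReal.tsum_const_eq_top_of_ne_zero hne)
  have hae : ∀ᵐ ω ∂P, ω ∈ limsup (fun i => X i ⁻¹' S) atTop := by
    rw [← prob_compl_eq_zero_iff (MeasurableSet.measurableSet_limsup hmeas)] at hone
    exact hone
  filter_upwards [hae] with ω hω
  exact (mem_limsup_iff_frequently_mem.1 hω).exists

/-! ### Exponential inequality conditional on one observation -/

theorem lintegral_exp_mul_le {α : Type*} [MeasurableSpace α] {μ : Measure α}
    [IsProbabilityMeasure μ] {Y : α → ℝ} (hY : Measurable Y) {b v c : ℝ}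
    (hb : ∀ y, |Y y| ≤ b) (h0 : ∫ y, Y y ∂μ = 0) (hv : ∫ y, Y y ^ 2 ∂μ ≤ v)
    (hc : |c| * b ≤ 1) :
    ∫⁻ y, ENNReal.ofReal (Real.exp (c * Y y)) ∂μ ≤ ENNReal.ofReal (Real.exp (c ^ 2 * v)) := by
  have hcY : ∀ y, |c * Y y| ≤ 1 := fun y => by
    rw [abs_mul]
    exact (mul_le_mul_of_nonneg_left (hb y) (abs_nonneg c)).trans hc
  have hiY : Integrable Y μ :=
    Integrable.of_bound hY.aestronglyMeasurable b (ae_of_all _ hb)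
  have hiY2 : Integrable (fun y => Y y ^ 2) μ := by
    refine Integrable.of_bound (hY.pow_const 2).aestronglyMeasurable (b ^ 2) (ae_of_all _ ?_)
    intro y
    rw [Real.norm_eq_abs, abs_pow]
    exact pow_le_pow_left₀ (abs_nonneg _) (hb y) 2
  have hiE : Integrable (fun y => Real.exp (c * Y y)) μ := by
    refine Integrable.of_bound (by fun_prop) (Real.exp 1) (ae_of_all _ ?_)
    intro y
    rw [Real.norm_eq_abs, Real.abs_exp]
    exact Real.exp_le_exp.2 ((le_abs_self _).trans (hcY y))
  rw [← ofReal_integral_eq_lintegral_ofReal hiE (ae_of_all _ fun y => (Real.exp_pos _).le)]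
  refine ENNReal.ofReal_le_ofReal ?_
  -- `exp z ≤ 1 + z + z ^ 2` for `|z| ≤ 1`; the linear term integrates to zero.
  have hle : ∀ y, Real.exp (c * Y y) ≤ (1 + c * Y y) + c ^ 2 * Y y ^ 2 := fun y => by
    have := (abs_le.1 (Real.abs_exp_sub_one_sub_id_le (hcY y))).2
    nlinarith
  calc ∫ y, Real.exp (c * Y y) ∂μ
      ≤ ∫ y, ((1 + c * Y y) + c ^ 2 * Y y ^ 2) ∂μ :=
        integral_mono hiE (((integrable_const 1).add (hiY.const_mul c)).add
          (hiY2.const_mul _)) hle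
    _ = 1 + c ^ 2 * ∫ y, Y y ^ 2 ∂μ := by
        have hi1 : Integrable (fun y => 1 + c * Y y) μ :=
          (integrable_const 1).add (hiY.const_mul c)
        rw [integral_add hi1 (hiY2.const_mul _),
          integral_add (integrable_const 1) (hiY.const_mul c), integral_const_mul,
          integral_const_mul, h0]
        simp
    _ ≤ 1 + c ^ 2 * v := by gcongr
    _ ≤ Real.exp (c ^ 2 * v) := by linarith [Real.add_one_le_exp (c ^ 2 * v)]

/-- Given `X i`, the summands are independent and centred. Instead of conditioning, the induction
integrates out one `X k` at a time, with the one-variable bound uniform in the first argument of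
`W`. -/
theorem lintegral_exp_sum_le {Ω E : Type*} [MeasurableSpace Ω] [MeasurableSpace E]
    {P : Measure Ω} [IsProbabilityMeasure P] {μ : Measure E} [IsProbabilityMeasure μ]
    {X : ℕ → Ω → E} (hXm : ∀ i, Measurable (X i)) (hind : iIndepFun X P)
    (hlaw : ∀ i, P.map (X i) = μ) {W : E → E → ℝ} (hW : Measurable (Function.uncurry W))
    {b v c : ℝ} (hb : ∀ x y, |W x y| ≤ b) (h0 : ∀ x, ∫ y, W x y ∂μ = 0)
    (hv : ∀ x, ∫ y, W x y ^ 2 ∂μ ≤ v) (hc : |c| * b ≤ 1) (i : ℕ) (s : Finset ℕ) (hi : i ∉ s) :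
    ∫⁻ ω, ENNReal.ofReal (Real.exp (c * ∑ j ∈ s, W (X i ω) (X j ω))) ∂P ≤
      ENNReal.ofReal (Real.exp (c ^ 2 * v)) ^ s.card := by
  induction s using Finset.induction_on with
  | empty => simp
  | insert k s hk ih =>
    have his : i ∉ s := fun h => hi (Finset.mem_insert_of_mem h)
    have hik : k ≠ i := fun h => hi (h ▸ Finset.mem_insert_self k s)
    specialize ih his
    -- The block independent of `X k` must include `X i`, which occurs in every summand.
    have hdisj : Disjoint (insert i s) {k} := by
      simp [hk, hik]
    have hind2 : IndepFun (fun ω (j : (insert i s : Finset ℕ)) => X j ω) (X k) P :=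
      (hind.indepFun_finset (insert i s) {k} hdisj hXm).comp measurable_id
        (measurable_pi_apply (⟨k, Finset.mem_singleton_self k⟩ : ({k} : Finset ℕ)))
    have hZm : Measurable fun ω (j : (insert i s : Finset ℕ)) => X j ω :=
      measurable_pi_lambda _ fun j => hXm j
    have hprod := (indepFun_iff_map_prod_eq_prod_map_map hZm.aemeasurable
      (hXm k).aemeasurable).1 hind2
    rw [hlaw k] at hprod
    set i' : (insert i s : Finset ℕ) := ⟨i, Finset.mem_insert_self i s⟩ with hi'
    let inc : {j // j ∈ s} → (insert i s : Finset ℕ) :=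
      fun j => ⟨j, Finset.mem_insert_of_mem j.2⟩
    let a : ({j // j ∈ insert i s} → E) → ℝ≥0∞ := fun z =>
      ENNReal.ofReal (Real.exp (c * ∑ j ∈ s.attach, W (z i') (z (inc j))))
    let e : E → E → ℝ≥0∞ := fun x y => ENNReal.ofReal (Real.exp (c * W x y))
    have ha : Measurable a := by
      refine ENNReal.measurable_ofReal.comp (Real.measurable_exp.comp
        ((Finset.measurable_sum _ fun j _ => ?_).const_mul c))
      have hp : Measurable fun z : {j // j ∈ insert i s} → E => (z i', z (inc j)) :=
        (measurable_pi_apply _).prodMk (measurable_pi_apply _)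
      exact hW.comp hp
    have he : Measurable (Function.uncurry e) :=
      ENNReal.measurable_ofReal.comp (Real.measurable_exp.comp (hW.const_mul c))
    have hF : Measurable fun q : ({j // j ∈ insert i s} → E) × E => a q.1 * e (q.1 i') q.2 := by
      have hp : Measurable fun q : ({j // j ∈ insert i s} → E) × E => (q.1 i', q.2) :=
        ((measurable_pi_apply i').comp measurable_fst).prodMk measurable_snd
      exact (ha.comp measurable_fst).mul (he.comp hp)
    have haX : ∀ ω, a (fun j => X j ω) =
        ENNReal.ofReal (Real.exp (c * ∑ j ∈ s, W (X i ω) (X j ω))) := fun ω => by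
      simp only [a, inc, hi']
      rw [Finset.sum_attach s fun j => W (X i ω) (X j ω)]
    calc ∫⁻ ω, ENNReal.ofReal (Real.exp (c * ∑ j ∈ insert k s, W (X i ω) (X j ω))) ∂P
        = ∫⁻ ω, a (fun j => X j ω) * e (X i ω) (X k ω) ∂P := by
          refine lintegral_congr fun ω => ?_
          rw [haX, ← ENNReal.ofReal_mul (Real.exp_pos _).le, ← Real.exp_add,
            Finset.sum_insert hk]
          congr 2
          ring
      _ = ∫⁻ q, a q.1 * e (q.1 i') q.2
            ∂(P.map fun ω => ((fun j : (insert i s : Finset ℕ) => X j ω), X k ω)) := by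
          rw [lintegral_map hF (hZm.prodMk (hXm k))]
      _ = ∫⁻ z, a z * ∫⁻ y, e (z i') y ∂μ
            ∂(P.map fun ω (j : (insert i s : Finset ℕ)) => X j ω) := by
          rw [hprod, lintegral_prod _ hF.aemeasurable]
          refine lintegral_congr fun z => ?_
          have hez : Measurable fun y => e (z i') y := he.comp measurable_prodMk_left
          exact lintegral_const_mul (a z) hez
      _ ≤ ∫⁻ z, a z * ENNReal.ofReal (Real.exp (c ^ 2 * v))
            ∂(P.map fun ω (j : (insert i s : Finset ℕ)) => X j ω) := by
          refine lintegral_mono fun z => mul_le_mul_right ?_ _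
          exact lintegral_exp_mul_le (hW.comp (measurable_const.prodMk measurable_id))
            (hb _) (h0 _) (hv _) hc
      _ = (∫⁻ ω, ENNReal.ofReal (Real.exp (c * ∑ j ∈ s, W (X i ω) (X j ω))) ∂P) *
            ENNReal.ofReal (Real.exp (c ^ 2 * v)) := by
          rw [lintegral_mul_const _ ha, lintegral_map ha hZm]
          simp only [haX]
      _ ≤ ENNReal.ofReal (Real.exp (c ^ 2 * v)) ^ (insert k s).card := by
          rw [Finset.card_insert_of_notMem hk, pow_succ]
          exact mul_le_mul_left ih _

theorem measure_le_sum_le {Ω E : Type*} [MeasurableSpace Ω] [MeasurableSpace E]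
    {P : Measure Ω} [IsProbabilityMeasure P] {μ : Measure E} [IsProbabilityMeasure μ]
    {X : ℕ → Ω → E} (hXm : ∀ i, Measurable (X i)) (hind : iIndepFun X P)
    (hlaw : ∀ i, P.map (X i) = μ) {W : E → E → ℝ} (hW : Measurable (Function.uncurry W))
    {b v c a : ℝ} (hb : ∀ x y, |W x y| ≤ b) (h0 : ∀ x, ∫ y, W x y ∂μ = 0)
    (hv : ∀ x, ∫ y, W x y ^ 2 ∂μ ≤ v) (hc0 : 0 ≤ c) (hc : c * b ≤ 1) (i : ℕ) (s : Finset ℕ)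
    (hi : i ∉ s) :
    P {ω | a ≤ ∑ j ∈ s, W (X i ω) (X j ω)} ≤
      ENNReal.ofReal (Real.exp (s.card * (c ^ 2 * v) - c * a)) := by
  have hmeas : Measurable fun ω => ENNReal.ofReal (Real.exp (c * ∑ j ∈ s, W (X i ω) (X j ω))) :=
    ENNReal.measurable_ofReal.comp (Real.measurable_exp.comp
      ((Finset.measurable_sum _ fun j _ => hW.comp ((hXm i).prodMk (hXm j))).const_mul c))
  calc P {ω | a ≤ ∑ j ∈ s, W (X i ω) (X j ω)}
      ≤ P {ω | ENNReal.ofReal (Real.exp (c * a)) ≤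
          ENNReal.ofReal (Real.exp (c * ∑ j ∈ s, W (X i ω) (X j ω)))} := by
        refine measure_mono fun ω hω => ?_
        exact ENNReal.ofReal_le_ofReal (Real.exp_le_exp.2 (mul_le_mul_of_nonneg_left hω hc0))
    _ ≤ (∫⁻ ω, ENNReal.ofReal (Real.exp (c * ∑ j ∈ s, W (X i ω) (X j ω))) ∂P) /
          ENNReal.ofReal (Real.exp (c * a)) :=
        meas_ge_le_lintegral_div hmeas.aemeasurable
          (by simpa using Real.exp_pos _) ENNReal.ofReal_ne_top
    _ ≤ ENNReal.ofReal (Real.exp (c ^ 2 * v)) ^ s.card / ENNReal.ofReal (Real.exp (c * a)) := by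
        gcongr
        exact lintegral_exp_sum_le hXm hind hlaw hW hb h0 hv (by rwa [abs_of_nonneg hc0]) i s hi
    _ = ENNReal.ofReal (Real.exp (s.card * (c ^ 2 * v) - c * a)) := by
        rw [← ENNReal.ofReal_pow (Real.exp_pos _).le, ← ENNReal.ofReal_div_of_pos (Real.exp_pos _),
          Real.exp_sub, Real.exp_nat_mul]

theorem measure_le_abs_sum_le {Ω E : Type*} [MeasurableSpace Ω] [MeasurableSpace E]
    {P : Measure Ω} [IsProbabilityMeasure P] {μ : Measure E} [IsProbabilityMeasure μ]
    {X : ℕ → Ω → E} (hXm : ∀ i, Measurable (X i)) (hind : iIndepFun X P)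
    (hlaw : ∀ i, P.map (X i) = μ) {W : E → E → ℝ} (hW : Measurable (Function.uncurry W))
    {b v c a : ℝ} (hb : ∀ x y, |W x y| ≤ b) (h0 : ∀ x, ∫ y, W x y ∂μ = 0)
    (hv : ∀ x, ∫ y, W x y ^ 2 ∂μ ≤ v) (hc0 : 0 ≤ c) (hc : c * b ≤ 1) (i : ℕ) (s : Finset ℕ)
    (hi : i ∉ s) :
    P {ω | a ≤ |∑ j ∈ s, W (X i ω) (X j ω)|} ≤
      2 * ENNReal.ofReal (Real.exp (s.card * (c ^ 2 * v) - c * a)) := by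
  have h1 := measure_le_sum_le hXm hind hlaw hW (a := a) hb h0 hv hc0 hc i s hi
  have h2 := measure_le_sum_le hXm hind hlaw (W := fun x y => -W x y) hW.neg (a := a) (v := v)
    (by simpa using hb) (by simpa [integral_neg] using h0) (by simpa using hv) hc0 hc i s hi
  rw [two_mul]
  refine (measure_mono ?_).trans ((measure_union_le _ _).trans (add_le_add h1 h2))
  intro ω hω
  simp only [mem_ofPred_eq, le_abs] at hω
  simpa [Finset.sum_neg_distrib] using hω

/-! ### Rates, bandwidth and kernel smoothing -/

theorem tendsto_log_div_rpow {a : ℝ} (ha : 0 < a) :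
    Tendsto (fun n : ℕ => (Real.log n / n) ^ a) atTop (𝓝 0) := by
  have h1 : Tendsto (fun n : ℕ => Real.log n / (n : ℝ)) atTop (𝓝 0) := by
    have := (Real.tendsto_pow_log_div_mul_add_atTop 1 0 1 one_ne_zero).comp
      (tendsto_natCast_atTop_atTop (R := ℝ))
    simpa [Function.comp_def] using this
  simpa [Real.zero_rpow ha.ne'] using h1.rpow_const (Or.inr ha.le) (p := a)

theorem tendsto_gap {d p : ℕ} (hp : 1 ≤ p) (M : ℝ) : Tendsto (gap d p M) atTop (𝓝 0) := by
  have hp' : (0 : ℝ) < p := by exact_mod_cast hp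
  have := (tendsto_log_div_rpow
    (a := (p : ℝ) / ((d : ℝ) + 2 * (p : ℝ))) (by positivity)).const_mul M
  rwa [mul_zero] at this

section Kernel

variable {d p : ℕ} {K : EuclideanSpace ℝ (Fin d) → ℝ} {h : ℕ → ℝ}

theorem AssumptionK.tendsto_bandwidth (hK : AssumptionK K h p) (hp : 1 ≤ p) :
    Tendsto h atTop (𝓝 0) := by
  have hp' : (0 : ℝ) < p := by exact_mod_cast hp
  exact hK.bandwidth_order.1.trans_tendsto (tendsto_log_div_rpow (by positivity))

/-- With `r = log n / n` and `q = d + 2p`, `n h ^ d` is of order `n r ^ (d / q) = log n * r ^ (-2p /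
q)`, and the last factor tends to infinity. -/
theorem AssumptionK.mul_log_le (hK : AssumptionK K h p) (hp : 1 ≤ p) (A : ℝ) :
    ∀ᶠ n : ℕ in atTop, A * Real.log n ≤ n * h n ^ d := by
  have hp' : (0 : ℝ) < p := by exact_mod_cast hp
  set q : ℝ := (d : ℝ) + 2 * (p : ℝ) with hq
  have hq0 : 0 < q := by positivity
  obtain ⟨c, hc, hbound⟩ := hK.bandwidth_order.2.exists_pos
  have hlim := (tendsto_log_div_rpow (a := 2 * (p : ℝ) / q) (by positivity)).const_mul A
  rw [mul_zero] at hlim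
  have hcd : (0 : ℝ) < (c⁻¹) ^ d := by positivity
  filter_upwards [hbound.bound, hK.bandwidth_pos, hlim.eventually (gt_mem_nhds hcd),
    eventually_ge_atTop 2] with n h1 h2 h3 h4
  have hn : (2 : ℝ) ≤ n := by exact_mod_cast h4
  have hlog : 0 < Real.log n := Real.log_pos (by linarith)
  set r : ℝ := Real.log n / n with hr
  have hr0 : 0 < r := by positivity
  rw [Real.norm_of_nonneg (by positivity), Real.norm_of_nonneg h2.le] at h1
  have h5 : c⁻¹ * r ^ (1 / q) ≤ h n := by
    rw [inv_mul_le_iff₀ hc]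
    exact h1
  have h6 : (c⁻¹) ^ d * r ^ ((d : ℝ) / q) ≤ h n ^ d := by
    have := pow_le_pow_left₀ (by positivity) h5 d
    rw [mul_pow, ← Real.rpow_natCast (r ^ (1 / q)), ← Real.rpow_mul hr0.le] at this
    rwa [one_div_mul_eq_div] at this
  have h7 : r = r ^ (2 * (p : ℝ) / q) * r ^ ((d : ℝ) / q) := by
    rw [← Real.rpow_add hr0, ← add_div, add_comm, ← hq, div_self hq0.ne', Real.rpow_one]
  have h8 : Real.log n = n * r := by
    rw [hr]; field_simp
  calc A * Real.log n = n * (A * r ^ (2 * (p : ℝ) / q) * r ^ ((d : ℝ) / q)) := by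
        rw [h8, mul_assoc A, ← h7]; ring
    _ ≤ n * ((c⁻¹) ^ d * r ^ ((d : ℝ) / q)) := by gcongr
    _ ≤ n * h n ^ d := by gcongr

theorem integral_comp_inv_smul_sub (g : EuclideanSpace ℝ (Fin d) → ℝ) {b : ℝ} (hb : 0 < b)
    (x : EuclideanSpace ℝ (Fin d)) :
    ∫ y, g (b⁻¹ • (x - y)) = b ^ d * ∫ z, g z := by
  rw [integral_sub_left_eq_self (fun y => g (b⁻¹ • y)) volume x, Measure.integral_comp_smul]
  simp [abs_of_pos hb]

theorem integrable_comp_inv_smul_sub {g : EuclideanSpace ℝ (Fin d) → ℝ} (hg : Integrable g)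
    {b : ℝ} (hb : 0 < b) (x : EuclideanSpace ℝ (Fin d)) :
    Integrable fun y => g (b⁻¹ • (x - y)) :=
  (hg.comp_smul (inv_ne_zero hb.ne')).comp_sub_left x

theorem AssumptionK.exists_bound (hK : AssumptionK K h p) :
    ∃ B > 0, ∀ z, |K z| ≤ B := by
  have hcs : HasCompactSupport K := hK.bounded_support.isCompact_closure
  obtain ⟨B, hB⟩ := hcs.exists_bound_of_continuous hK.continuous
  exact ⟨max B 1, by positivity, fun z => (hB z).trans (le_max_left _ _)⟩

theorem AssumptionK.exists_radius (hK : AssumptionK K h p) :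
    ∃ R > 0, ∀ z, R < ‖z‖ → K z = 0 := by
  obtain ⟨R, hR, hsub⟩ := hK.bounded_support.subset_closedBall_lt 0 0
  refine ⟨R, hR, fun z hz => ?_⟩
  by_contra hne
  have := hsub hne
  rw [mem_closedBall_zero_iff] at this
  linarith

theorem AssumptionK.integrable_sq (hK : AssumptionK K h p) : Integrable fun z => K z ^ 2 := by
  obtain ⟨B, -, hB⟩ := hK.exists_bound
  have := hK.order.integrable.bdd_mul (c := B) hK.continuous.aestronglyMeasurable
    (ae_of_all _ hB)
  simpa [pow_two] using this

/-- Lebesgue points: the smoothed functions `K_h * f` converge to `f` almost everywhere. -/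
theorem AssumptionK.ae_tendsto_smoothing (hK : AssumptionK K h p) (hp : 1 ≤ p)
    {f : EuclideanSpace ℝ (Fin d) → ℝ} (hf : Integrable f) :
    ∀ᵐ x, Tendsto (fun n => (h n ^ d)⁻¹ * ∫ y, K ((h n)⁻¹ • (x - y)) * f y) atTop
      (𝓝 (f x)) := by
  obtain ⟨B, hB0, hB⟩ := hK.exists_bound
  obtain ⟨R, hR0, hR⟩ := hK.exists_radius
  have hδ : Tendsto (fun n => R * h n) atTop (𝓝[>] 0) := by
    refine tendsto_nhdsWithin_iff.2 ⟨by simpa using (hK.tendsto_bandwidth hp).const_mul R, ?_⟩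
    filter_upwards [hK.bandwidth_pos] with n hn
    exact mul_pos hR0 hn
  filter_upwards [IsUnifLocDoublingMeasure.ae_tendsto_average_norm_sub volume
    hf.locallyIntegrable 1] with x hx
  have hav := hx (fun _ => x) (fun n => R * h n) hδ (by
    filter_upwards [hK.bandwidth_pos] with n hn
    exact Metric.mem_closedBall_self (by positivity))
  set V : ℝ := volume.real (Metric.ball (0 : EuclideanSpace ℝ (Fin d)) 1) with hV
  rw [tendsto_iff_norm_sub_tendsto_zero]
  -- `|K| ≤ B`, and the ball of radius `R h` has volume `(R h) ^ d V`; after division by `h ^ d`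
  -- this constant remains in front of the average.
  have hlim := hav.const_mul (B * R ^ d * V)
  rw [mul_zero] at hlim
  refine squeeze_zero' (Eventually.of_forall fun n => norm_nonneg _) ?_ hlim
  filter_upwards [hK.bandwidth_pos] with n hn
  have hKi := integrable_comp_inv_smul_sub hK.order.integrable hn x
  have hKf : Integrable fun y => K ((h n)⁻¹ • (x - y)) * f y :=
    hf.bdd_mul (c := B) hKi.aestronglyMeasurable (ae_of_all _ fun y => hB _)
  have hball : 0 < volume.real (Metric.closedBall x (R * h n)) := by
    rw [Measure.real, ENNReal.toReal_pos_iff]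
    exact ⟨Metric.measure_closedBall_pos _ _ (by positivity), measure_closedBall_lt_top⟩
  have hvol : volume.real (Metric.closedBall x (R * h n)) = (R * h n) ^ d * V := by
    rw [Measure.addHaar_real_closedBall _ _ (by positivity)]
    simp [hV]
  -- Since `∫ K = 1`, `f x` can be moved inside the integral.
  have hdiff : (h n ^ d)⁻¹ * ∫ y, K ((h n)⁻¹ • (x - y)) * f y =
      f x + (h n ^ d)⁻¹ * ∫ y, K ((h n)⁻¹ • (x - y)) * (f y - f x) := by
    have : ∫ y, K ((h n)⁻¹ • (x - y)) * (f y - f x) =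
        (∫ y, K ((h n)⁻¹ • (x - y)) * f y) - h n ^ d * f x := by
      simp only [mul_sub]
      rw [integral_sub hKf (hKi.mul_const _), integral_mul_const,
        integral_comp_inv_smul_sub K hn x, hK.order.integral_eq_one, mul_one]
    rw [this]
    field_simp
    ring
  have hfi : IntegrableOn (fun y => ‖f y - f x‖) (Metric.closedBall x (R * h n)) :=
    (hf.integrableOn.sub (integrableOn_const measure_closedBall_lt_top.ne)).norm
  have hint : ‖∫ y, K ((h n)⁻¹ • (x - y)) * (f y - f x)‖ ≤
      B * ∫ y in Metric.closedBall x (R * h n), ‖f y - f x‖ := by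
    have hset : ∫ y in Metric.closedBall x (R * h n), K ((h n)⁻¹ • (x - y)) * (f y - f x) =
        ∫ y, K ((h n)⁻¹ • (x - y)) * (f y - f x) := by
      refine setIntegral_eq_integral_of_forall_compl_eq_zero fun y hy => ?_
      rw [hR, zero_mul]
      rw [Metric.mem_closedBall, not_le, dist_comm, dist_eq_norm] at hy
      rw [norm_smul, norm_inv, Real.norm_of_nonneg hn.le, lt_inv_mul_iff₀ hn]
      linarith
    rw [← hset, ← integral_const_mul]
    refine norm_integral_le_of_norm_le (hfi.const_mul B) (ae_of_all _ fun y => ?_)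
    rw [norm_mul]
    exact mul_le_mul_of_nonneg_right (hB _) (norm_nonneg _)
  rw [hdiff, add_sub_cancel_left, norm_mul, setAverage_eq, smul_eq_mul,
    Real.norm_of_nonneg (by positivity)]
  calc (h n ^ d)⁻¹ * ‖∫ y, K ((h n)⁻¹ • (x - y)) * (f y - f x)‖
      ≤ (h n ^ d)⁻¹ * (B * ∫ y in Metric.closedBall x (R * h n), ‖f y - f x‖) := by gcongr
    _ = _ := by
      have hV0 : V ≠ 0 := fun h0 => by
        rw [hvol, h0, mul_zero] at hball
        exact lt_irrefl _ hball
      rw [hvol, mul_pow]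
      field_simp

end Kernel

theorem IsDensity.integrable {d : ℕ} {f : EuclideanSpace ℝ (Fin d) → ℝ} (hf : IsDensity f) :
    Integrable f := by
  refine ⟨hf.measurable.aestronglyMeasurable, ?_⟩
  rw [hasFiniteIntegral_iff_ofReal (ae_of_all _ hf.nonneg), hf.lintegral_eq_one]
  exact ENNReal.one_lt_top

theorem IsDensity.integral_withDensity {d : ℕ} {f : EuclideanSpace ℝ (Fin d) → ℝ}
    (hf : IsDensity f) (g : EuclideanSpace ℝ (Fin d) → ℝ) :
    ∫ y, g y ∂(volume.withDensity fun x => ENNReal.ofReal (f x)) = ∫ y, g y * f y := by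
  rw [integral_withDensity_eq_integral_toReal_smul hf.measurable.ennreal_ofReal
    (ae_of_all _ fun _ => ENNReal.ofReal_lt_top)]
  refine integral_congr_ae (ae_of_all _ fun y => ?_)
  simp [ENNReal.toReal_ofReal (hf.nonneg y), mul_comm]

theorem IsDensity.isProbabilityMeasure {d : ℕ} {f : EuclideanSpace ℝ (Fin d) → ℝ}
    (hf : IsDensity f) :
    IsProbabilityMeasure (volume.withDensity fun x => ENNReal.ofReal (f x)) :=
  ⟨by rw [withDensity_apply _ MeasurableSet.univ, setLIntegral_univ, hf.lintegral_eq_one]⟩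

/-- First Borel–Cantelli lemma; shifting the index discards the finitely many `n` at which the bound
may fail. -/
theorem ae_eventually_notMem_of_eventually_le {Ω : Type*} [MeasurableSpace Ω] {P : Measure Ω}
    {A : ℕ → Set Ω} {b : ℕ → ℝ} (hb : Summable b)
    (hA : ∀ᶠ n in atTop, P (A n) ≤ ENNReal.ofReal (b n)) :
    ∀ᵐ ω ∂P, ∀ᶠ n in atTop, ω ∉ A n := by
  obtain ⟨N, hN⟩ := eventually_atTop.1 hA
  have hsum : ∑' n, P (A (n + N)) ≠ ∞ := by
    refine ne_top_of_le_ne_top ((summable_nat_add_iff N).2 hb).tsum_ofReal_ne_top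
      (ENNReal.tsum_le_tsum fun n => hN _ (Nat.le_add_left N n))
  filter_upwards [ae_eventually_notMem hsum] with ω hω
  obtain ⟨m, hm⟩ := eventually_atTop.1 hω
  refine eventually_atTop.2 ⟨m + N, fun n hn => ?_⟩
  have := hm (n - N) (by omega)
  rwa [Nat.sub_add_cancel (by omega)] at this

/-! ### Strong consistency of the estimator at a fixed observation -/

section Consistency

variable {d p : ℕ} {K : EuclideanSpace ℝ (Fin d) → ℝ} {h : ℕ → ℝ}
  {f : EuclideanSpace ℝ (Fin d) → ℝ}

/-- The kernel term `K ((x - y) / b)`, centred in `y` with respect to the density `f`. -/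
noncomputable def centeredKernel (K f : EuclideanSpace ℝ (Fin d) → ℝ) (b : ℝ)
    (x y : EuclideanSpace ℝ (Fin d)) : ℝ :=
  K (b⁻¹ • (x - y)) - ∫ z, K (b⁻¹ • (x - z)) * f z

theorem measurable_centeredKernel (hKm : Measurable K) (hf : IsDensity f) (b : ℝ) :
    Measurable (Function.uncurry (centeredKernel K f b)) := by
  have h1 : Measurable fun q : EuclideanSpace ℝ (Fin d) × EuclideanSpace ℝ (Fin d) =>
      K (b⁻¹ • (q.1 - q.2)) :=
    hKm.comp (by fun_prop)
  have h2 : Measurable fun x => ∫ z, K (b⁻¹ • (x - z)) * f z := by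
    have hm := (h1.mul (hf.measurable.comp measurable_snd)).stronglyMeasurable
    exact (hm.integral_prod_right (ν := volume)).measurable
  exact h1.sub (h2.comp measurable_fst)

theorem abs_centeredKernel_le {B : ℝ} (hB : ∀ z, |K z| ≤ B) (hf : IsDensity f) (b : ℝ)
    (x y : EuclideanSpace ℝ (Fin d)) : |centeredKernel K f b x y| ≤ 2 * B := by
  have := hf.isProbabilityMeasure
  have h1 : |∫ z, K (b⁻¹ • (x - z)) * f z| ≤ B := by
    rw [← hf.integral_withDensity, ← Real.norm_eq_abs]
    simpa using norm_integral_le_of_norm_le_const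
      (μ := volume.withDensity fun x => ENNReal.ofReal (f x))
      (f := fun z => K (b⁻¹ • (x - z))) (C := B) (ae_of_all _ fun z => hB (b⁻¹ • (x - z)))
  calc _ ≤ |K (b⁻¹ • (x - y))| + |∫ z, K (b⁻¹ • (x - z)) * f z| := abs_sub _ _
    _ ≤ 2 * B := by linarith [hB (b⁻¹ • (x - y))]

theorem AssumptionK.integrable_withDensity (hK : AssumptionK K h p) (hf : IsDensity f) (b : ℝ)
    (x : EuclideanSpace ℝ (Fin d)) :
    Integrable (fun y => K (b⁻¹ • (x - y)))
      (volume.withDensity fun x => ENNReal.ofReal (f x)) := by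
  have := hf.isProbabilityMeasure
  obtain ⟨B, -, hB⟩ := hK.exists_bound
  have hc := hK.continuous
  exact Integrable.of_bound (by fun_prop) B (ae_of_all _ fun y => hB _)

theorem AssumptionK.integral_centeredKernel (hK : AssumptionK K h p) (hf : IsDensity f) (b : ℝ)
    (x : EuclideanSpace ℝ (Fin d)) :
    ∫ y, centeredKernel K f b x y ∂(volume.withDensity fun x => ENNReal.ofReal (f x)) = 0 := by
  have := hf.isProbabilityMeasure
  simp only [centeredKernel]
  rw [integral_sub (hK.integrable_withDensity hf b x) (integrable_const _),
    ← hf.integral_withDensity]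
  simp

/-- The variance is at most the second moment; bounding `f` by `F` and rescaling yields the factor
`b ^ d`. -/
theorem AssumptionK.integral_centeredKernel_sq_le (hK : AssumptionK K h p) (hf : IsDensity f)
    {F : ℝ} (hF : ∀ x, f x ≤ F) {b : ℝ} (hb : 0 < b) (x : EuclideanSpace ℝ (Fin d)) :
    ∫ y, centeredKernel K f b x y ^ 2 ∂(volume.withDensity fun x => ENNReal.ofReal (f x)) ≤
      b ^ d * (F * ∫ z, K z ^ 2) := by
  have := hf.isProbabilityMeasure
  set μ := volume.withDensity fun x => ENNReal.ofReal (f x) with hμ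
  obtain ⟨B, -, hB⟩ := hK.exists_bound
  have hc := hK.continuous
  set a : ℝ := ∫ z, K (b⁻¹ • (x - z)) * f z with ha
  have ha' : ∫ y, K (b⁻¹ • (x - y)) ∂μ = a := hf.integral_withDensity _
  have hi1 := hK.integrable_withDensity hf b x
  have hi2 : Integrable (fun y => K (b⁻¹ • (x - y)) ^ 2) μ := by
    refine Integrable.of_bound (by fun_prop) (B ^ 2) (ae_of_all _ fun y => ?_)
    rw [Real.norm_eq_abs, abs_pow]
    exact pow_le_pow_left₀ (abs_nonneg _) (hB _) 2
  have hi3 := integrable_comp_inv_smul_sub hK.integrable_sq hb x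
  calc ∫ y, centeredKernel K f b x y ^ 2 ∂μ
      = ∫ y, (K (b⁻¹ • (x - y)) ^ 2 - (2 * a * K (b⁻¹ • (x - y)) - a ^ 2)) ∂μ := by
        refine integral_congr_ae (ae_of_all _ fun y => ?_)
        simp only [centeredKernel, ← ha]
        ring
    _ = ∫ y, K (b⁻¹ • (x - y)) ^ 2 ∂μ - a ^ 2 := by
        have hi4 : Integrable (fun y => 2 * a * K (b⁻¹ • (x - y)) - a ^ 2) μ :=
          (hi1.const_mul _).sub (integrable_const _)
        rw [integral_sub hi2 hi4,
          integral_sub (hi1.const_mul _) (integrable_const _), integral_const_mul, ha']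
        simp
        ring
    _ ≤ ∫ y, K (b⁻¹ • (x - y)) ^ 2 ∂μ := by linarith [sq_nonneg a]
    _ = ∫ y, K (b⁻¹ • (x - y)) ^ 2 * f y := hf.integral_withDensity _
    _ ≤ ∫ y, F * K (b⁻¹ • (x - y)) ^ 2 := by
        refine integral_mono_of_nonneg (ae_of_all _ fun y => ?_) (hi3.const_mul F)
          (ae_of_all _ fun y => ?_)
        · exact mul_nonneg (sq_nonneg _) (hf.nonneg y)
        · simp only [mul_comm F]
          exact mul_le_mul_of_nonneg_left (hF y) (sq_nonneg _)
    _ = b ^ d * (F * ∫ z, K z ^ 2) := by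
        rw [integral_const_mul, integral_comp_inv_smul_sub (fun z => K z ^ 2) hb x]
        ring

theorem IsRandomSample.ae_eventually_abs_sum_centeredKernel_lt (hK : AssumptionK K h p)
    (hp : 1 ≤ p) (hf : IsDensity f) (hbdd : BddAbove (range f)) {Ω : Type*} [MeasurableSpace Ω]
    {P : Measure Ω} [IsProbabilityMeasure P] {X : ℕ → Ω → EuclideanSpace ℝ (Fin d)}
    (hX : IsRandomSample P X f) (i : ℕ) {η : ℝ} (hη : 0 < η) :
    ∀ᵐ ω ∂P, ∀ᶠ n : ℕ in atTop,
      |∑ j ∈ (Finset.range n).erase i, centeredKernel K f (h n) (X i ω) (X j ω)| <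
        η * (n * h n ^ d) := by
  have := hf.isProbabilityMeasure
  obtain ⟨F, hF⟩ := hbdd
  replace hF : ∀ x, f x ≤ F := fun x => hF (mem_range_self x)
  have hF0 : 0 ≤ F := (hf.nonneg 0).trans (hF 0)
  obtain ⟨B, hB0, hB⟩ := hK.exists_bound
  set C : ℝ := F * ∫ z, K z ^ 2 with hC
  have hC0 : 0 ≤ C := mul_nonneg hF0 (integral_nonneg fun z => sq_nonneg _)
  -- The first condition admits the exponential inequality; the second lets the variance term cost
  -- at most half of the deviation term. Adding one to `C` avoids division by zero.
  obtain ⟨c, hc0, hcB, hcC⟩ : ∃ c > 0, c * (2 * B) ≤ 1 ∧ c * C ≤ η / 2 := by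
    refine ⟨min (1 / (2 * B)) (η / 2 / (C + 1)), by positivity, ?_, ?_⟩
    · rw [← le_div_iff₀ (by positivity)]
      exact min_le_left _ _
    · calc _ ≤ η / 2 / (C + 1) * (C + 1) := by
            gcongr
            · exact min_le_right _ _
            · linarith
        _ = η / 2 := by field_simp
  have hsum : Summable fun n : ℕ => 2 * ((n : ℝ) ^ 2)⁻¹ :=
    (Real.summable_nat_pow_inv.2 one_lt_two).mul_left 2
  have key := ae_eventually_notMem_of_eventually_le (P := P) (A := fun n => {ω |
    η * (n * h n ^ d) ≤
      |∑ j ∈ (Finset.range n).erase i, centeredKernel K f (h n) (X i ω) (X j ω)|}) hsum ?_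
  · filter_upwards [key] with ω hω
    filter_upwards [hω] with n hn
    exact not_le.1 hn
  -- The exponent will be at most `-(c * η / 2) * n h ^ d`; the factor `4 / (c * η)` turns this into
  -- `-2 log n`.
  filter_upwards [hK.bandwidth_pos, hK.mul_log_le hp (4 / (c * η)), eventually_ge_atTop 1]
    with n hn hlog hn1
  have hn0 : (0 : ℝ) < n := by exact_mod_cast hn1
  refine (measure_le_abs_sum_le hX.measurable hX.indep hX.law
    (measurable_centeredKernel hK.continuous.measurable hf (h n))
    (abs_centeredKernel_le hB hf (h n)) (hK.integral_centeredKernel hf (h n))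
    (hK.integral_centeredKernel_sq_le hf hF hn) hc0.le hcB i _ (Finset.notMem_erase i _)).trans ?_
  rw [ENNReal.ofReal_mul zero_le_two, ENNReal.ofReal_ofNat]
  refine mul_le_mul_right (ENNReal.ofReal_le_ofReal ?_) _
  have hcard : (((Finset.range n).erase i).card : ℝ) ≤ n := by
    exact_mod_cast (Finset.card_erase_le).trans (Finset.card_range n).le
  have hlog' : 2 * Real.log n ≤ c * η / 2 * (n * h n ^ d) := by
    rw [div_mul_eq_mul_div, div_le_iff₀ (by positivity)] at hlog
    linarith
  have hN : 0 ≤ (n : ℝ) * h n ^ d := by positivity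
  rw [← Real.exp_log (x := ((n : ℝ) ^ 2)⁻¹) (by positivity), Real.log_inv, Real.log_pow]
  refine Real.exp_le_exp.2 ?_
  calc (((Finset.range n).erase i).card : ℝ) * (c ^ 2 * (h n ^ d * (F * ∫ z, K z ^ 2))) -
          c * (η * (n * h n ^ d))
      ≤ n * (c ^ 2 * (h n ^ d * C)) - c * (η * (n * h n ^ d)) := by gcongr
    _ = c * (n * h n ^ d) * (c * C - η) := by ring
    _ ≤ c * (n * h n ^ d) * (-(η / 2)) := by
        gcongr
        linarith
    _ ≤ -(((2 : ℕ) : ℝ) * Real.log n) := by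
        push_cast
        linarith

/-- Strong consistency of the kernel estimator at the sample points. -/
theorem IsRandomSample.ae_tendsto_kernelEstimator (hK : AssumptionK K h p)
    (hp : 1 ≤ p) (hf : IsDensity f) (hbdd : BddAbove (range f)) {Ω : Type*} [MeasurableSpace Ω]
    {P : Measure Ω} [IsProbabilityMeasure P] {X : ℕ → Ω → EuclideanSpace ℝ (Fin d)}
    (hX : IsRandomSample P X f) (i : ℕ) :
    ∀ᵐ ω ∂P, Tendsto (fun n => kernelEstimator K (h n) (fun j => X j ω) n (X i ω)) atTop
      (𝓝 (f (X i ω))) := by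
  have hbias : ∀ᵐ ω ∂P, Tendsto (fun n => (h n ^ d)⁻¹ *
      ∫ y, K ((h n)⁻¹ • (X i ω - y)) * f y) atTop (𝓝 (f (X i ω))) := by
    have hmap := (withDensity_absolutelyContinuous volume fun x => ENNReal.ofReal (f x)).ae_le
      (hK.ae_tendsto_smoothing hp hf.integrable)
    rw [← hX.law i] at hmap
    exact ae_of_ae_map (hX.measurable i).aemeasurable hmap
  -- Countably many thresholds, so that one null set serves every `η`.
  have hfluct : ∀ᵐ ω ∂P, ∀ k : ℕ, ∀ᶠ n : ℕ in atTop,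
      |∑ j ∈ (Finset.range n).erase i, centeredKernel K f (h n) (X i ω) (X j ω)| <
        (1 / ((k : ℝ) + 1)) * (n * h n ^ d) :=
    ae_all_iff.2 fun k => hX.ae_eventually_abs_sum_centeredKernel_lt hK hp hf hbdd i
      (by positivity)
  filter_upwards [hbias, hfluct] with ω hb hfl
  have hvar : Tendsto (fun n : ℕ => (1 / ((n : ℝ) * h n ^ d)) *
      ∑ j ∈ (Finset.range n).erase i, centeredKernel K f (h n) (X i ω) (X j ω)) atTop (𝓝 0) := by
    rw [Metric.tendsto_nhds]
    intro η hη
    obtain ⟨k, hk⟩ := exists_nat_one_div_lt hη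
    filter_upwards [hfl k, hK.bandwidth_pos, eventually_ge_atTop 1] with n h1 h2 h3
    have hn0 : (0 : ℝ) < n := by exact_mod_cast h3
    have hN : 0 < (n : ℝ) * h n ^ d := by positivity
    rw [dist_zero_right, norm_mul, Real.norm_of_nonneg (by positivity), one_div_mul_eq_div,
      div_lt_iff₀ hN, Real.norm_eq_abs]
    exact h1.trans_le (mul_le_mul_of_nonneg_right hk.le hN.le)
  have hN : Tendsto (fun n : ℕ => (n : ℝ) * h n ^ d) atTop atTop := by
    refine tendsto_atTop_mono' atTop (hK.mul_log_le hp 1) ?_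
    simpa [Function.comp_def] using Real.tendsto_log_atTop.comp (tendsto_natCast_atTop_atTop (R := ℝ))
  -- The term `j = i` of the estimator is `K 0`, not random. The other `n - 1` terms carry the bias,
  -- hence the factor `1 - 1 / n` below.
  have hself : Tendsto (fun n : ℕ => (1 / ((n : ℝ) * h n ^ d)) * K 0) atTop (𝓝 0) := by
    simpa using hN.inv_tendsto_atTop.mul_const (K 0)
  have hfrac : Tendsto (fun n : ℕ => 1 - 1 / (n : ℝ)) atTop (𝓝 1) := by
    simpa using tendsto_one_div_atTop_nhds_zero_nat.const_sub (1 : ℝ)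
  have hlim := (hself.add hvar).add (hfrac.mul hb)
  rw [zero_add, zero_add, one_mul] at hlim
  refine hlim.congr' ?_
  filter_upwards [hK.bandwidth_pos, eventually_gt_atTop i] with n h1 h2
  have hn0 : (0 : ℝ) < n := by exact_mod_cast (Nat.zero_le i).trans_lt h2
  have hmem : i ∈ Finset.range n := Finset.mem_range.2 h2
  have hcard : (((Finset.range n).erase i).card : ℝ) = n - 1 := by
    rw [Finset.card_erase_of_mem hmem, Finset.card_range, Nat.cast_pred (by omega)]
  rw [kernelEstimator, ← Finset.add_sum_erase _ _ hmem]
  simp only [centeredKernel, Finset.sum_sub_distrib, Finset.sum_const, nsmul_eq_mul, hcard,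
    sub_self, smul_zero]
  field_simp
  ring

end Consistency

/-! ### Compactness and conclusion -/

/-- Closed level sets give upper semicontinuity at levels in `[l, u]`, even where `f` is not
continuous. The condition `t ≤ f x` is the intersection over levels `s` of the closed conditions `t
≤ s` or `s ≤ f x`. -/
theorem isCompact_hypograph {d : ℕ} {f : EuclideanSpace ℝ (Fin d) → ℝ} {l u : ℝ}
    (hlu : l ≤ u) (hG : ∀ t ∈ Icc l u, IsCompact (levelSet f t)) :
    IsCompact {q : EuclideanSpace ℝ (Fin d) × ℝ | q.2 ∈ Icc l u ∧ q.2 ≤ f q.1} := by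
  have hset : {q : EuclideanSpace ℝ (Fin d) × ℝ | q.2 ∈ Icc l u ∧ q.2 ≤ f q.1} =
      (levelSet f l ×ˢ Icc l u) ∩ ⋂ s ∈ Icc l u, (univ ×ˢ Iic s ∪ levelSet f s ×ˢ univ) := by
    ext ⟨x, t⟩
    simp only [mem_ofPred_eq, mem_inter_iff, mem_prod, mem_univ, true_and, mem_iInter, mem_union,
      mem_Iic, and_true, levelSet]
    constructor
    · rintro ⟨ht, hx⟩
      refine ⟨⟨ht.1.trans hx, ht⟩, fun s _ => ?_⟩
      exact (le_total t s).imp_right fun hst => hst.trans hx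
    · rintro ⟨⟨hlx, ht⟩, hs⟩
      refine ⟨ht, ?_⟩
      -- If `l ≤ f x < t`, the midpoint is a level of `[l, u]` separating them.
      by_contra! hlt
      rcases hs ((f x + t) / 2) ⟨by linarith, by linarith [ht.2]⟩ with h1 | h1 <;> linarith
  rw [hset]
  refine ((hG l ⟨le_rfl, hlu⟩).prod isCompact_Icc).inter_right
    (isClosed_biInter fun s hs => ?_)
  exact (isClosed_univ.prod isClosed_Iic).union ((hG s hs).isClosed.prod isClosed_univ)

/-- This yields `l > 0`, hence a positive density on the sets that the sample has to hit. -/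
theorem IsDensity.pos_of_not_convex {d : ℕ} {f : EuclideanSpace ℝ (Fin d) → ℝ}
    (hf : IsDensity f) {t : ℝ} (ht : ¬ Convex ℝ (levelSet f t)) : 0 < t := by
  by_contra! h0
  have huniv : levelSet f t = univ := eq_univ_of_forall fun x => h0.trans (hf.nonneg x)
  exact ht (huniv ▸ convex_univ)

theorem IsRandomSample.ae_eventually_exists_plusSample_dist_lt {d p : ℕ}
    {f : EuclideanSpace ℝ (Fin d) → ℝ} {l u : ℝ} {K : EuclideanSpace ℝ (Fin d) → ℝ} {h : ℕ → ℝ}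
    (hf : IsDensity f) (hA : AssumptionA f l u p) (hK : AssumptionK K h p)
    (hG : ∀ t ∈ Icc l u, IsCompact (levelSet f t)) (hl : 0 < l) (M : ℝ)
    {Ω : Type*} [MeasurableSpace Ω] {P : Measure Ω} [IsProbabilityMeasure P]
    {X : ℕ → Ω → EuclideanSpace ℝ (Fin d)} (hX : IsRandomSample P X f) {ε : ℝ} (hε : 0 < ε) :
    ∀ᵐ ω ∂P, ∀ᶠ n in atTop, ∀ t ∈ Icc l u, ∀ x ∈ levelSet f t,
      ∃ y ∈ plusSample K (h n) (gap d p M n) (fun i => X i ω) n t, dist x y < ε := by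
  set C := {q : EuclideanSpace ℝ (Fin d) × ℝ | q.2 ∈ Icc l u ∧ q.2 ≤ f q.1} with hC
  have hε2 : 0 < ε / 2 := half_pos hε
  have hδ : ∀ q ∈ C, ∃ δ > 0,
      0 < volume (Metric.ball q.1 (ε / 2) ∩ {y | q.2 + δ < f y}) := fun q hq =>
    exists_volume_ball_inter_superlevel_add_pos hA hq.1 hq.2 hε2
  choose! δ hδ0 hδvol using hδ
  obtain ⟨T, hTC, hT⟩ := (isCompact_hypograph hA.l_le_u hG).elim_nhds_subcover
    -- The plus samples decrease in `t`, so one observation valid at level `q.2 + δ q / 2` serves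
    -- every lower level. The other half of the margin `δ q` absorbs `D_n`.
    (fun q => Metric.ball q.1 (ε / 2) ×ˢ Iio (q.2 + δ q / 2)) fun q hq =>
      prod_mem_nhds (Metric.ball_mem_nhds _ hε2) (Iio_mem_nhds (by linarith [hδ0 q hq]))
  have hhit : ∀ᵐ ω ∂P, ∀ q ∈ T,
      ∃ i, X i ω ∈ Metric.ball q.1 (ε / 2) ∩ {y | q.2 + δ q < f y} := by
    refine (eventually_all_finset T).2 fun q hq => ?_
    refine hX.ae_exists_mem hf.measurable
      (measurableSet_ball.inter (measurableSet_lt measurable_const hf.measurable))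
      (hδvol q (hTC q hq)) fun y hy => ?_
    have h1 : q.2 + δ q < f y := hy.2
    linarith [(hTC q hq).1.1, hδ0 q (hTC q hq)]
  have hcons := ae_all_iff.2 fun i =>
    hX.ae_tendsto_kernelEstimator hK hA.one_le_p hf hA.bddAbove i
  filter_upwards [hhit, hcons] with ω hω hcω
  have hev : ∀ᶠ n in atTop, ∀ q ∈ T,
      ∃ y ∈ plusSample K (h n) (gap d p M n) (fun i => X i ω) n (q.2 + δ q / 2),
        dist q.1 y < ε / 2 := by
    refine (eventually_all_finset T).2 fun q hq => ?_
    obtain ⟨i, hib, hif⟩ := hω q hq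
    filter_upwards [(hcω i).eventually (lt_mem_nhds hif), eventually_gt_atTop i,
      (tendsto_gap (d := d) hA.one_le_p M).eventually (gt_mem_nhds (half_pos (hδ0 q (hTC q hq))))]
      with n h1 h2 h3
    refine ⟨X i ω, ⟨⟨i, h2, rfl⟩, by linarith⟩, ?_⟩
    rw [dist_comm]
    exact hib
  filter_upwards [hev] with n hn t ht x hx
  obtain ⟨q, hqT, hxq, htq⟩ := mem_iUnion₂.1 (hT (show (x, t) ∈ C from ⟨ht, hx⟩))
  obtain ⟨y, hy, hqy⟩ := hn q hqT
  have htq' : t < q.2 + δ q / 2 := htq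
  have hxq' : dist x q.1 < ε / 2 := hxq
  refine ⟨y, ⟨hy.1, by linarith [hy.2]⟩, ?_⟩
  linarith [dist_triangle x q.1 y]

end LevelSetEstimation

theorem proposition2p2 {d p : ℕ} (f : EuclideanSpace ℝ (Fin d) → ℝ) (l u : ℝ)
    (K : EuclideanSpace ℝ (Fin d) → ℝ) (h : ℕ → ℝ)
    (hf : LevelSetEstimation.IsDensity f)
    (hA : LevelSetEstimation.AssumptionA f l u p)
    (hK : LevelSetEstimation.AssumptionK K h p)
    (hG : ∀ t ∈ Set.Icc l u, IsCompact (LevelSetEstimation.levelSet f t) ∧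
      (LevelSetEstimation.levelSet f t).Nonempty ∧
      ¬ Convex ℝ (LevelSetEstimation.levelSet f t)) :
    ∃ M₀ > 0, ∀ M ≥ M₀,
      ∀ {Ω : Type*} [MeasurableSpace Ω] (P : Measure Ω) [IsProbabilityMeasure P]
        (X : ℕ → Ω → EuclideanSpace ℝ (Fin d)),
        LevelSetEstimation.IsRandomSample P X f →
        (∀ ε : ℝ, 0 < ε → ∀ᵐ ω ∂P, ∀ᶠ n in atTop,
          (⨆ t ∈ Set.Icc l u, ⨆ x ∈ LevelSetEstimation.levelSet f t,
            Metric.infEDist x (LevelSetEstimation.plusSample K (h n)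
              (LevelSetEstimation.gap d p M n) (fun i => X i ω) n t)) ≤ ENNReal.ofReal ε) ∧
        (∀ᵐ ω ∂P, ∀ᶠ n in atTop, ∀ t ∈ Set.Icc l u,
          (LevelSetEstimation.plusSample K (h n)
            (LevelSetEstimation.gap d p M n) (fun i => X i ω) n t).Nonempty) := by
  have hl : 0 < l := hf.pos_of_not_convex (hG l ⟨le_rfl, hA.l_le_u⟩).2.2
  -- The value `1` is arbitrary: `D_n → 0` for every `M`.
  refine ⟨1, one_pos, fun M _ Ω _ P _ X hX => ?_⟩
  have key := fun {ε : ℝ} (hε : 0 < ε) =>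
    hX.ae_eventually_exists_plusSample_dist_lt hf hA hK (fun t ht => (hG t ht).1) hl M hε
  refine ⟨fun ε hε => ?_, ?_⟩
  · filter_upwards [key hε] with ω hω
    filter_upwards [hω] with n hn
    refine iSup₂_le fun t ht => iSup₂_le fun x hx => ?_
    obtain ⟨y, hy, hxy⟩ := hn t ht x hx
    refine (Metric.infEDist_le_edist_of_mem hy).trans ?_
    rw [edist_dist]
    exact ENNReal.ofReal_le_ofReal hxy.le
  · filter_upwards [key one_pos] with ω hω
    filter_upwards [hω] with n hn t ht
    obtain ⟨x, hx⟩ := (hG t ht).2.1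
    obtain ⟨y, hy, -⟩ := hn t ht x hx
    exact ⟨y, hy⟩
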